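/- Let $P$ be a finite poset. A \emph{decomposition} of $P$ is a triple $(x,z,y)$ with $x\le z\le y$ for which there is an isomorphism of posets $\psi:[x,z]\times[z,y]\to[x,y]$ with $\psi(u,z)=u$ and $\psi(z,v)=v$ for all $u\in[x,z]$, $v\in[z,y]$; let $\mathcal G_{\max}$ be the set of all decompositions of $P$. For $A\subseteq P$ let $\langle A\rangle$ be the intersection of all $B$ with $A\subseteq B\subseteq P$ such that $x,y\in B$ implies $z\in B$ for every $(x,z,y)\in\mathcal G_{\max}$. Let $\mathcal D(P,\mathcal G_{\max})=\{\langle C\rangle : C \text{ a non-empty chain in } P\}$, ordered by inclusion. Let $M$ be a finite loopfree matroid on the ground set $E$, and let $\mathcal L_M$ be its lattice of flats, with bottom $\hat 0$ and top $\hat 1=E$. For a weight vector $\omega\in\mathbb R^E$ let the matroid type $M_\omega$ be the matroid on $E$ whose bases are the bases $b$ of $M$ of maximal weight $\sum_{e\in b}\omega_e$, and let $\sigma_\omega\subseteq\mathbb R^E$ be the closure of the set of all $\omega'$ with $M_{\omega'}=M_\omega$. The Bergman fan of $M$ is the set of the cones $\sigma_\omega$ with $M_\omega$ loopfree; its face poset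 is this set ordered by inclusion. \textbf{Theorem.} For $M_\omega$, $M_{\omega'}$ loopfree, $\sigma_\omega\subseteq\sigma_{\omega'}$ if and only if every basis of $M_{\omega'}$ is a basis of $M_\omega$; thus the face poset of the Bergman fan is the poset of loopfree matroid types of $M$ under reversed inclusion of bases. The map $$\sigma_\omega\ (\text{or } M_\omega)\;\longmapsto\;\{A\in\mathcal L_M : \operatorname{rank}(A)=|A\cap b|\ \text{for every basis } b \text{ of } M_\omega\}$$ is a well-defined embedding of posets (it preserves and reflects the order, hence is injective) of the face poset of the Bergman fan into $\mathcal D(\mathcal L_M,\mathcal G_{\max})$. Its image consists exactly of those members of $\mathcal D(\mathcal L_M,\mathcal G_{\max})$ that contain both $\hat 0$ and $\hat 1$. -/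

import Mathlib

/-! ### Decompositions and decomposition complexes of posets -/

section Decomposition

variable {P : Type*} [PartialOrder P]

/-- `(x, z, y)` is a decomposition: `x ≤ z ≤ y`, and `[x,z] × [z,y] ≅ [x,y]` via an isomorphism `ψ`
of posets with `ψ (u, z) = u` and `ψ (z, v) = v`. The trivial cases `z = x`, `z = y` are allowed. -/
def IsDecomposition (x z y : P) : Prop :=
  ∃ (hxz : x ≤ z) (hzy : z ≤ y) (ψ : Set.Icc x z × Set.Icc z y ≃o Set.Icc x y),
    (∀ u : Set.Icc x z, (ψ (u, ⟨z, Set.left_mem_Icc.2 hzy⟩) : P) = u) ∧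
    (∀ v : Set.Icc z y, (ψ (⟨z, Set.right_mem_Icc.2 hxz⟩, v) : P) = v)

theorem isDecomposition_left {x y : P} (h : x ≤ y) : IsDecomposition x x y := by
  have key : ∀ a : Set.Icc x x, a = ⟨x, Set.left_mem_Icc.2 le_rfl⟩ := fun a =>
    Subtype.ext (le_antisymm a.2.2 a.2.1)
  refine ⟨le_rfl, h,
    { toFun := fun p => p.2
      invFun := fun v => (⟨x, Set.left_mem_Icc.2 le_rfl⟩, v)
      left_inv := fun p => Prod.ext (key p.1).symm rfl
      right_inv := fun v => rfl
      map_rel_iff' := ?_ }, ?_, fun v => rfl⟩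
  · intro p q
    refine ⟨fun hpq => ⟨?_, hpq⟩, fun hpq => hpq.2⟩
    rw [key p.1, key q.1]
  · intro u
    rw [key u]
    rfl

theorem isDecomposition_right {x y : P} (h : x ≤ y) : IsDecomposition x y y := by
  have key : ∀ a : Set.Icc y y, a = ⟨y, Set.left_mem_Icc.2 le_rfl⟩ := fun a =>
    Subtype.ext (le_antisymm a.2.2 a.2.1)
  refine ⟨h, le_rfl,
    { toFun := fun p => p.1
      invFun := fun v => (v, ⟨y, Set.left_mem_Icc.2 le_rfl⟩)
      left_inv := fun p => Prod.ext rfl (key p.2).symm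
      right_inv := fun v => rfl
      map_rel_iff' := ?_ }, fun u => rfl, ?_⟩
  · intro p q
    refine ⟨fun hpq => ⟨hpq, ?_⟩, fun hpq => hpq.1⟩
    rw [key p.2, key q.2]
  · intro v
    rw [key v]
    rfl

variable (P) in
/-- A decomposition set of `P`: a set of decompositions containing all the trivial ones. -/
structure DecompositionSet where
  carrier : Set (P × P × P)
  isDecomposition : ∀ x z y : P, (x, z, y) ∈ carrier → IsDecomposition x z y
  left_mem : ∀ x y : P, x ≤ y → (x, x, y) ∈ carrier
  right_mem : ∀ x y : P, x ≤ y → (x, y, y) ∈ carrier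

variable (P) in
/-- The maximal decomposition set, consisting of all decompositions. -/
def DecompositionSet.max : DecompositionSet P where
  carrier := {t | IsDecomposition t.1 t.2.1 t.2.2}
  isDecomposition := fun _ _ _ h => h
  left_mem := fun _ _ h => isDecomposition_left h
  right_mem := fun _ _ h => isDecomposition_right h

/-- The closure `⟨A⟩_G`: the intersection of all `B ⊇ A` such that
`x, y ∈ B` implies `z ∈ B` for each `(x, z, y) ∈ G`. -/
def DecompositionSet.closure (G : DecompositionSet P) (A : Set P) : Set P :=
  ⋂₀ {B | A ⊆ B ∧ ∀ x z y : P, (x, z, y) ∈ G.carrier → x ∈ B → y ∈ B → z ∈ B}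

variable (P) in
/-- The decomposition complex `D(P, G)`, the set of all `⟨C⟩_G` for `C` a non-empty chain in `P`.
As a type it is ordered by inclusion. -/
def decompositionComplex (G : DecompositionSet P) : Set (Set P) :=
  {A | ∃ C : Set P, C.Nonempty ∧ IsChain (· ≤ ·) C ∧ A = G.closure C}

end Decomposition

/-! ### The lattice of flats -/

namespace Matroid

variable {α : Type*}

/-- The lattice of flats of `M`, ordered by inclusion. -/
abbrev FlatLattice (M : Matroid α) : Type _ := {F : Set α // M.IsFlat F}

/-- The bottom `0̂` is the closure of the empty set, the top `1̂` is the ground set. -/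
instance FlatLattice.instBoundedOrder (M : Matroid α) : BoundedOrder M.FlatLattice where
  top := ⟨M.E, M.ground_isFlat⟩
  le_top := fun F => F.2.subset_ground
  bot := ⟨M.closure ∅, M.isFlat_closure ∅⟩
  bot_le := fun F => F.2.loops_subset

/-! ### Matroid types and the Bergman fan -/

/-- The total weight of the set `B` for a weight vector `ω` on the ground set. -/
noncomputable def weight (M : Matroid α) (ω : M.E → ℝ) (B : Set α) : ℝ :=
  ∑ᶠ e ∈ ((↑) ⁻¹' B : Set M.E), ω e

/-- `B` is a basis of `M` of maximal `ω`-weight, that is, a possible output of the greedy algorithm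
for `ω`; equivalently the incidence vector of `B` is a vertex of the face of the matroid polytope
on which `ω` is maximal. -/
def IsMaxWeightBase (M : Matroid α) (ω : M.E → ℝ) (B : Set α) : Prop :=
  M.IsBase B ∧ ∀ B', M.IsBase B' → M.weight ω B' ≤ M.weight ω B

theorem weight_exchange (M : Matroid α) [M.Finite] (ω : M.E → ℝ) {B : Set α} {e f : α}
    (heE : e ∈ M.E) (hfE : f ∈ M.E) (he : e ∈ B) (hf : f ∉ B) :
    M.weight ω (insert f (B \ {e})) + ω ⟨e, heE⟩ = M.weight ω B + ω ⟨f, hfE⟩ := by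
  have : Finite M.E := M.ground_finite
  have h1 : ((↑) ⁻¹' (insert f (B \ {e})) : Set M.E)
      = insert ⟨f, hfE⟩ ((↑) ⁻¹' (B \ {e}) : Set M.E) := by
    ext x; simp [Subtype.ext_iff]
  have h2 : ((↑) ⁻¹' B : Set M.E) = insert ⟨e, heE⟩ ((↑) ⁻¹' (B \ {e}) : Set M.E) := by
    ext x
    simp only [Set.mem_preimage, Set.mem_insert_iff, Subtype.ext_iff, Set.mem_sdiff,
      Set.mem_singleton_iff]
    by_cases hx : (x : α) = e
    · simp [hx, he]
    · simp [hx]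
  unfold weight
  rw [h1, h2, finsum_mem_insert _ (by simp [hf]) (Set.toFinite _),
    finsum_mem_insert _ (by simp) (Set.toFinite _)]
  ring

theorem exists_symm_exchange (M : Matroid α) {B₁ B₂ : Set α} (h₁ : M.IsBase B₁)
    (h₂ : M.IsBase B₂) {e : α} (he : e ∈ B₁ \ B₂) :
    ∃ f ∈ B₂ \ B₁, M.IsBase (insert f (B₁ \ {e})) ∧ M.IsBase (insert e (B₂ \ {f})) := by
  have heE : e ∈ M.E := h₁.subset_ground he.1
  have hC := h₂.fundCircuit_isCircuit heE he.2
  have hK := fundCocircuit_isCocircuit he.1 h₁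
  have hne := (hC.isCocircuit_inter_nontrivial hK
    ⟨e, M.mem_fundCircuit e B₂, M.mem_fundCocircuit e B₁⟩)
  obtain ⟨f, ⟨hfC, hfK⟩, hfe⟩ := hne.exists_ne e
  have hf2 : f ∈ B₂ := (M.fundCircuit_subset_insert e B₂ hfC).resolve_left hfe
  have hf1 : f ∉ B₁ := ((M.fundCocircuit_subset_insert_compl e B₁ hfK).resolve_left hfe).2
  have hfE : f ∈ M.E := h₂.subset_ground hf2
  refine ⟨f, ⟨hf2, hf1⟩, ?_, ?_⟩
  · have h := (h₁.mem_fundCocircuit_iff_mem_fundCircuit (e := f) (f := e)).1 hfK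
    rw [h₁.indep.mem_fundCircuit_iff (by rw [h₁.closure_eq]; exact hfE) hf1] at h
    have hi : M.Indep (insert f (B₁ \ {e})) := by
      rwa [← Set.insert_sdiff_singleton_comm hfe] at h
    exact h₁.exchange_isBase_of_indep hf1 hi
  · rw [h₂.indep.mem_fundCircuit_iff (by rw [h₂.closure_eq]; exact heE) he.2] at hfC
    rw [← Set.insert_sdiff_singleton_comm (Ne.symm hfe)] at hfC
    exact h₂.exchange_isBase_of_indep he.2 hfC

theorem isMaxWeightBase_exchange (M : Matroid α) [M.Finite] (ω : M.E → ℝ) :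
    Matroid.ExchangeProperty (M.IsMaxWeightBase ω) := by
  intro B₁ B₂ h₁ h₂ e he
  obtain ⟨f, hf, hb₁, hb₂⟩ := M.exists_symm_exchange h₁.1 h₂.1 he
  have heE : e ∈ M.E := h₁.1.subset_ground he.1
  have hfE : f ∈ M.E := h₂.1.subset_ground hf.1
  have w₁ := M.weight_exchange ω heE hfE he.1 hf.2
  have w₂ := M.weight_exchange ω hfE heE hf.1 he.2
  have l₂ := h₂.2 _ hb₂
  refine ⟨f, hf, hb₁, fun B' hB' => ?_⟩
  have l₁ := h₁.2 B' hB'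
  linarith

theorem exists_isMaxWeightBase (M : Matroid α) [M.Finite] (ω : M.E → ℝ) :
    ∃ B, M.IsMaxWeightBase ω B := by
  have hfin : {B | M.IsBase B}.Finite :=
    M.ground_finite.finite_subsets.subset fun B hB => hB.subset_ground
  obtain ⟨B, hB, hmax⟩ := hfin.exists_maximalFor (M.weight ω) _ M.exists_isBase
  refine ⟨B, hB, fun B' hB' => ?_⟩
  rcases le_total (M.weight ω B') (M.weight ω B) with h | h
  · exact h
  · exact hmax hB' h

/-- The matroid type `M_ω`: the matroid on the ground set of `M` whose bases are the bases of `M`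
of maximal `ω`-weight. -/
def matroidType (M : Matroid α) [M.Finite] (ω : M.E → ℝ) : Matroid α :=
  Matroid.ofIsBaseOfFinite M.ground_finite (M.IsMaxWeightBase ω) (M.exists_isMaxWeightBase ω)
    (M.isMaxWeightBase_exchange ω) (fun _ hB => hB.1.subset_ground)

/-- The (closed) cone of the normal fan of the matroid polytope that belongs to `M_ω`: the closure of
the set of all weight vectors which induce the same matroid type as `ω`. -/
def typeCone (M : Matroid α) [M.Finite] (ω : M.E → ℝ) : Set (M.E → ℝ) :=
  _root_.closure {ω' | M.matroidType ω' = M.matroidType ω}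

/-- The Bergman fan of `M`: the set of those cones whose induced matroid type is loopfree.
As a type it is the face poset of the fan, ordered by inclusion of cones. -/
def bergmanFan (M : Matroid α) [M.Finite] : Set (Set (M.E → ℝ)) :=
  {σ | ∃ ω : M.E → ℝ, (M.matroidType ω).Loopless ∧ σ = M.typeCone ω}

end Matroid

namespace Matroid

variable {α : Type*} {M : Matroid α}

/-! ### Exchange and the greedy algorithm -/

/-! Call a set tight if it is spanned by its intersection with each basis of maximal weight; the map
sends `σ_ω` to the set of tight flats. By the greedy algorithm, upper level sets of `ω` are tight,
and a basis spanning all of them has maximal weight. So the tight flats recover `M_ω`, and inclusion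
of tight families is inclusion of cones (`setOf_isTight_subset_iff`).

The core is `setOf_isTight_eq_closure`: for loopfree `M_ω` the tight flats form the decomposition
closure of the chain of upper level sets. Tightness survives decompositions because the middle flat
`z` has a complement `z'` with `y = z ∪ z'`. Conversely, if one independent set spans flats `X` and
`Y` and `X ∪ Y` is a flat, then `(X ∩ Y, X, X ∪ Y)` is a decomposition; two of these per level build
`A ∩ F` from the level below.

For the image, a chain of flats through bottom and top is the chain of upper level sets of some
weight, and a weight whose upper level sets are flats has a loopfree type. -/

theorem IsBase.exists_exchange_of_mem_closure {b X Y : Set α} {e : α} (hb : M.IsBase b)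
    (hY : e ∈ M.closure (Y ∩ b)) (hX : e ∉ M.closure (X ∩ b)) (he : e ∉ b) :
    ∃ f ∈ b, f ∈ Y ∧ f ∉ X ∧ M.IsBase (insert e (b \ {f})) := by
  have hYi : M.Indep (Y ∩ b) := hb.indep.subset Set.inter_subset_right
  have hC := hYi.fundCircuit_isCircuit hY (fun h => he h.2)
  have hsub := M.fundCircuit_subset_insert e (Y ∩ b)
  have heq := hC.eq_fundCircuit_of_subset hb.indep
    (hsub.trans (Set.insert_subset_insert Set.inter_subset_right))
  obtain ⟨f, hfC, hf⟩ : ∃ f ∈ M.fundCircuit e (Y ∩ b), f ∉ insert e (X ∩ b) := by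
    -- Otherwise the circuit without `e` lies in `X ∩ b` and puts `e` in its closure.
    by_contra! h
    refine hX (M.closure_subset_closure ?_
      (hC.mem_closure_sdiff_singleton_of_mem (M.mem_fundCircuit e (Y ∩ b))))
    rintro x ⟨hx, hxe⟩
    exact (h x hx).resolve_left hxe
  obtain ⟨hfe, hfX⟩ := not_or.1 hf
  have hfYb := (hsub hfC).resolve_left hfe
  refine ⟨f, hfYb.2, hfYb.1, fun h => hfX ⟨h, hfYb.2⟩, ?_⟩
  have heE : e ∈ M.E := mem_ground_of_mem_closure hY
  rw [heq, hb.indep.mem_fundCircuit_iff (by rwa [hb.closure_eq]) he,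
    ← Set.insert_sdiff_singleton_comm (Ne.symm hfe)] at hfC
  exact hb.exchange_isBase_of_indep he hfC

/-- Sets of ground elements that contain with an element all elements of at least its weight. -/
def IsUpperLevel (M : Matroid α) (ω : M.E → ℝ) (S : Set α) : Prop :=
  S ⊆ M.E ∧ ∀ e f : M.E, (e : α) ∈ S → ω e ≤ ω f → (f : α) ∈ S

theorem isUpperLevel_le (M : Matroid α) (ω : M.E → ℝ) (t : ℝ) :
    M.IsUpperLevel ω {x | ∃ h : x ∈ M.E, t ≤ ω ⟨x, h⟩} := by
  refine ⟨fun x hx => hx.1, ?_⟩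
  rintro e f ⟨_, he⟩ hef
  exact ⟨f.2, he.trans hef⟩

theorem isUpperLevel_lt (M : Matroid α) (ω : M.E → ℝ) (t : ℝ) :
    M.IsUpperLevel ω {x | ∃ h : x ∈ M.E, t < ω ⟨x, h⟩} := by
  refine ⟨fun x hx => hx.1, ?_⟩
  rintro e f ⟨_, he⟩ hef
  exact ⟨f.2, he.trans_le hef⟩

theorem IsUpperLevel.total {ω : M.E → ℝ} {S T : Set α} (hS : M.IsUpperLevel ω S)
    (hT : M.IsUpperLevel ω T) : S ⊆ T ∨ T ⊆ S := by
  by_contra! h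
  obtain ⟨⟨x, hxS, hxT⟩, ⟨y, hyT, hyS⟩⟩ := Set.not_subset.1 h.1, Set.not_subset.1 h.2
  rcases le_total (ω ⟨x, hS.1 hxS⟩) (ω ⟨y, hT.1 hyT⟩) with h | h
  · exact hyS (hS.2 _ _ hxS h)
  · exact hxT (hT.2 _ _ hyT h)

/-- The sets that are spanned by each basis of maximal weight. -/
def IsTight (M : Matroid α) (ω : M.E → ℝ) (S : Set α) : Prop :=
  S ⊆ M.E ∧ ∀ b, M.IsMaxWeightBase ω b → S ⊆ M.closure (S ∩ b)

theorem IsTight.union {ω : M.E → ℝ} {S T : Set α} (hS : M.IsTight ω S) (hT : M.IsTight ω T) :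
    M.IsTight ω (S ∪ T) :=
  ⟨Set.union_subset hS.1 hT.1, fun b hb => Set.union_subset
    ((hS.2 b hb).trans (M.closure_subset_closure (by gcongr; exact Set.subset_union_left)))
    ((hT.2 b hb).trans (M.closure_subset_closure (by gcongr; exact Set.subset_union_right)))⟩

/-- Among subsets of one independent set, closure commutes with intersection. -/
theorem IsTight.inter {ω : M.E → ℝ} {S T : Set α} (hS : M.IsTight ω S) (hT : M.IsTight ω T) :
    M.IsTight ω (S ∩ T) := by
  refine ⟨Set.inter_subset_left.trans hS.1, fun b hb x hx => ?_⟩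
  have hi : M.Indep ((S ∩ b) ∪ (T ∩ b)) := hb.1.indep.subset (by simp)
  have h := hi.closure_inter_eq_inter_closure
  rw [Set.inter_inter_distrib_right, h]
  exact ⟨hS.2 b hb hx.1, hT.2 b hb hx.2⟩

variable [M.Finite]

theorem IsMaxWeightBase.exchange {ω : M.E → ℝ} {b : Set α} {e f : α}
    (hb : M.IsMaxWeightBase ω b) (heE : e ∈ M.E) (hfE : f ∈ M.E) (he : e ∉ b) (hf : f ∈ b)
    (hb' : M.IsBase (insert e (b \ {f}))) (hle : ω ⟨f, hfE⟩ ≤ ω ⟨e, heE⟩) :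
    M.IsMaxWeightBase ω (insert e (b \ {f})) := by
  refine ⟨hb', fun B hB => (hb.2 B hB).trans ?_⟩
  have := M.weight_exchange ω hfE heE hf he
  linarith

/-- An unspanned `e ∈ S` could replace some `f ∉ S` in `b`; maximality gives `ω e ≤ ω f`, which
forces `f ∈ S`. -/
theorem IsMaxWeightBase.subset_closure_inter {ω : M.E → ℝ} {b S : Set α}
    (hb : M.IsMaxWeightBase ω b) (hS : M.IsUpperLevel ω S) : S ⊆ M.closure (S ∩ b) := by
  intro e heS
  by_contra hecl
  have heE := hS.1 heS
  have heb : e ∉ b := fun h => hecl (M.mem_closure_of_mem' ⟨heS, h⟩ heE)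
  obtain ⟨f, hfb, -, hfS, hb'⟩ := hb.1.exists_exchange_of_mem_closure (Y := M.E)
    (by rwa [Set.inter_eq_self_of_subset_right hb.1.subset_ground, hb.1.closure_eq]) hecl heb
  have hfE := hb.1.subset_ground hfb
  have h1 := M.weight_exchange ω hfE heE hfb heb
  have h2 := hb.2 _ hb'
  exact hfS (hS.2 ⟨e, heE⟩ ⟨f, hfE⟩ heS (by linarith))

/-- The greedy algorithm: the bases of maximal weight are those that span each upper level set. -/
theorem isMaxWeightBase_of_forall_isUpperLevel {ω : M.E → ℝ} {b : Set α} (hb : M.IsBase b)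
    (h : ∀ S, M.IsUpperLevel ω S → S ⊆ M.closure (S ∩ b)) : M.IsMaxWeightBase ω b := by
  have hfin : {c | M.IsMaxWeightBase ω c}.Finite :=
    M.ground_finite.finite_subsets.subset fun c hc => hc.1.subset_ground
  -- Take `c` of maximal weight as close to `b` as possible; an exchange towards `b` that loses no
  -- weight contradicts this choice.
  obtain ⟨c, hc, hmin⟩ := hfin.exists_minimalFor (fun c => c \ b) _ (M.exists_isMaxWeightBase ω)
  suffices hcb : c ⊆ b by rwa [← hc.1.eq_of_subset_isBase hb hcb]
  by_contra hcb
  obtain ⟨e, hec, heb⟩ := Set.not_subset.1 hcb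
  obtain ⟨f, ⟨hfb, hfc⟩, hc', hb'⟩ := M.exists_symm_exchange hc.1 hb ⟨hec, heb⟩
  have heE := hc.1.subset_ground hec
  have hfE := hb.subset_ground hfb
  have hle : ω ⟨e, heE⟩ ≤ ω ⟨f, hfE⟩ := by
    -- If `f` is lighter than `e`, then `b` spans `e` by elements at least as heavy as `e`, hence
    -- without `f`; but exchanging `f` for `e` in `b` gives a basis.
    by_contra! hlt
    have he := h _ (M.isUpperLevel_le ω (ω ⟨e, heE⟩)) ⟨heE, le_rfl⟩
    have hnot := hb'.indep.notMem_closure_sdiff_of_mem (Set.mem_insert e _)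
    refine hnot (M.closure_subset_closure ?_ he)
    rintro x ⟨⟨hxE, hx⟩, hxb⟩
    refine ⟨Or.inr ⟨hxb, ?_⟩, fun hxe => heb (hxe ▸ hxb)⟩
    rintro rfl
    exact absurd hx (not_le.2 hlt)
  have hsub := hmin (hc.exchange hfE heE hfc hec hc' hle) (by
    rintro x ⟨rfl | hx, hxb⟩
    · exact absurd hfb hxb
    · exact ⟨hx.1, hxb⟩)
  rcases (hsub ⟨hec, heb⟩).1 with rfl | hx
  · exact hfc hec
  · exact hx.2 rfl

/-! ### Loopless matroid types -/

theorem matroidType_isBase_iff {ω : M.E → ℝ} {b : Set α} :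
    (M.matroidType ω).IsBase b ↔ M.IsMaxWeightBase ω b := Iff.rfl

theorem matroidType_loopless_iff {ω : M.E → ℝ} :
    (M.matroidType ω).Loopless ↔ ∀ e ∈ M.E, ∃ b, M.IsMaxWeightBase ω b ∧ e ∈ b := by
  rw [loopless_iff_forall_not_isLoop]
  refine forall₂_congr fun e he => ?_
  rw [isLoop_iff_forall_notMem_isBase (M := M.matroidType ω) he]
  simp [matroidType_isBase_iff]

theorem IsUpperLevel.isTight {ω : M.E → ℝ} {S : Set α} (hS : M.IsUpperLevel ω S) :
    M.IsTight ω S := ⟨hS.1, fun _ hb => hb.subset_closure_inter hS⟩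

/-- If `e ∈ cl S \ S`, a maximal basis `b` through `e` would have `e ∈ cl (S ∩ b) ⊆ cl (b \ {e})`.
-/
theorem IsTight.isFlat {ω : M.E → ℝ} (hω : (M.matroidType ω).Loopless) {S : Set α}
    (hS : M.IsTight ω S) : M.IsFlat S := by
  rw [isFlat_iff_closure_eq]
  refine (M.subset_closure S hS.1).antisymm' fun e he => ?_
  by_contra heS
  obtain ⟨b, hb, heb⟩ := matroidType_loopless_iff.1 hω e (mem_ground_of_mem_closure he)
  refine hb.1.indep.notMem_closure_sdiff_of_mem heb ?_
  have h := M.closure_subset_closure_of_subset_closure (hS.2 b hb) he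
  refine M.closure_subset_closure ?_ h
  rintro x ⟨hxS, hxb⟩
  exact ⟨hxb, fun hxe => heS (hxe ▸ hxS)⟩

/-- The elements heavier than `e` form a flat avoiding `e`, so `e` can replace an element of a
maximal basis that is no heavier than `e`. -/
theorem matroidType_loopless_of_isFlat {ω : M.E → ℝ}
    (h : ∀ S, M.IsUpperLevel ω S → M.IsFlat S) : (M.matroidType ω).Loopless := by
  rw [matroidType_loopless_iff]
  intro e heE
  obtain ⟨b, hb⟩ := M.exists_isMaxWeightBase ω
  by_cases heb : e ∈ b
  · exact ⟨b, hb, heb⟩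
  have hU := M.isUpperLevel_lt ω (ω ⟨e, heE⟩)
  obtain ⟨f, hfb, -, hfS, hb'⟩ := hb.1.exists_exchange_of_mem_closure (Y := M.E) (e := e)
    (by rwa [Set.inter_eq_self_of_subset_right hb.1.subset_ground, hb.1.closure_eq])
    (X := {x | ∃ h : x ∈ M.E, ω ⟨e, heE⟩ < ω ⟨x, h⟩})
    (fun hcl => by
      have := M.closure_subset_closure Set.inter_subset_left hcl
      rw [(h _ hU).closure] at this
      exact lt_irrefl _ this.2) heb
  have hfE := hb.1.subset_ground hfb
  exact ⟨_, hb.exchange heE hfE heb hfb hb' (not_lt.1 fun hlt => hfS ⟨hfE, hlt⟩),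
    Set.mem_insert _ _⟩

theorem isMaxWeightBase_of_isTight {ω ω' : M.E → ℝ} {b : Set α}
    (h : ∀ S, M.IsUpperLevel ω S → M.IsTight ω' S) (hb : M.IsMaxWeightBase ω' b) :
    M.IsMaxWeightBase ω b :=
  isMaxWeightBase_of_forall_isUpperLevel hb.1 fun S hS => (h S hS).2 b hb

/-- Tightness in terms of ranks. -/
theorem isTight_iff_eRk_eq {ω : M.E → ℝ} {S : Set α} (hSE : S ⊆ M.E) :
    M.IsTight ω S ↔ ∀ b, (M.matroidType ω).IsBase b → M.eRk S = (S ∩ b).encard := by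
  refine ⟨fun h b hb => ?_, fun h => ⟨hSE, fun b hb => ?_⟩⟩
  · have hi : M.Indep (S ∩ b) := hb.1.indep.subset Set.inter_subset_right
    exact (hi.isBasis_of_subset_of_subset_closure Set.inter_subset_left (h.2 b hb)).eRk_eq_encard
  · have hi : M.Indep (S ∩ b) := hb.1.indep.subset Set.inter_subset_right
    refine (hi.isBasis_of_eRk_ge (M.ground_finite.subset hi.subset_ground) Set.inter_subset_left
      ?_).subset_closure
    rw [h b hb, hi.eRk_eq_encard]

/-! ### The cones of the normal fan -/

theorem weight_add_smul (ω ν : M.E → ℝ) (ε : ℝ) (b : Set α) :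
    M.weight (ν + ε • ω) b = M.weight ν b + ε * M.weight ω b := by
  have : Finite M.E := M.ground_finite
  unfold weight
  simp_rw [finsum_mem_eq_finite_toFinset_sum _ (Set.toFinite _), Finset.mul_sum,
    ← Finset.sum_add_distrib]
  rfl

theorem continuous_weight (b : Set α) : Continuous fun ω : M.E → ℝ => M.weight ω b := by
  have : Finite M.E := M.ground_finite
  unfold weight
  simp_rw [finsum_mem_eq_finite_toFinset_sum _ (Set.toFinite _)]
  fun_prop

theorem matroidType_eq_iff {ω ω' : M.E → ℝ} : M.matroidType ω = M.matroidType ω' ↔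
    ∀ b, M.IsMaxWeightBase ω b ↔ M.IsMaxWeightBase ω' b := by
  rw [ext_iff_isBase]
  refine ⟨fun h b => ⟨fun hb => (h.2 (hb.1.subset_ground)).1 hb,
    fun hb => (h.2 (hb.1.subset_ground)).2 hb⟩, fun h => ⟨rfl, fun b _ => h b⟩⟩

theorem mem_typeCone_iff {ω ν : M.E → ℝ} :
    ν ∈ M.typeCone ω ↔ ∀ b, M.IsMaxWeightBase ω b → M.IsMaxWeightBase ν b := by
  constructor
  · intro hν b hb
    refine ⟨hb.1, fun B hB => ?_⟩
    have hcl : IsClosed {ν : M.E → ℝ | M.weight ν B ≤ M.weight ν b} :=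
      isClosed_le (continuous_weight B) (continuous_weight b)
    refine closure_minimal (fun μ hμ => ?_) hcl hν
    exact ((matroidType_eq_iff.1 hμ b).2 hb).2 B hB
  · intro h
    obtain ⟨b₀, hb₀⟩ := M.exists_isMaxWeightBase ω
    -- A basis maximal for `ω` maximizes both summands of `ν + ε • ω`, so the maximizers of the sum
    -- are exactly those of `ω`; let `ε` tend to `0`.
    have hmem : ∀ ε : ℝ, 0 < ε → M.matroidType (ν + ε • ω) = M.matroidType ω := by
      intro ε hε
      refine matroidType_eq_iff.2 fun b => ⟨fun hb => ⟨hb.1, fun B hB => ?_⟩, fun hb =>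
        ⟨hb.1, fun B hB => ?_⟩⟩
      · refine (hb₀.2 B hB).trans ?_
        have h1 := hb.2 b₀ hb₀.1
        have h2 := (h b₀ hb₀).2 b hb.1
        rw [weight_add_smul, weight_add_smul] at h1
        exact le_of_mul_le_mul_left (by linarith) hε
      · have h1 := mul_le_mul_of_nonneg_left (hb.2 B hB) hε.le
        have h2 := (h b hb).2 B hB
        rw [weight_add_smul, weight_add_smul]
        linarith
    have hlim : Filter.Tendsto (fun ε : ℝ => ν + ε • ω) (nhdsWithin 0 (Set.Ioi 0)) (nhds ν) := by
      have hc : Continuous fun ε : ℝ => ν + ε • ω := by fun_prop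
      have := hc.tendsto 0
      simp only [zero_smul, add_zero] at this
      exact this.mono_left nhdsWithin_le_nhds
    exact mem_closure_of_tendsto hlim (by
      filter_upwards [self_mem_nhdsWithin] with ε hε using hmem ε hε)

theorem typeCone_subset_iff {ω ω' : M.E → ℝ} : M.typeCone ω ⊆ M.typeCone ω' ↔
    ∀ b, M.IsMaxWeightBase ω' b → M.IsMaxWeightBase ω b := by
  refine ⟨fun h => mem_typeCone_iff.1 (h (mem_typeCone_iff.2 fun _ => id)), fun h ν hν => ?_⟩
  rw [mem_typeCone_iff] at hν ⊢
  exact fun b hb => hν b (h b hb)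

end Matroid

namespace Matroid

variable {α : Type*} {M : Matroid α}

/-! ### Decompositions of the lattice of flats -/

theorem IsFlat.inter {F G : Set α} (hF : M.IsFlat F) (hG : M.IsFlat G) : M.IsFlat (F ∩ G) := by
  rw [isFlat_iff_closure_eq]
  refine (M.subset_closure _ (Set.inter_subset_left.trans hF.subset_ground)).antisymm'
    (Set.subset_inter ?_ ?_)
  · exact (M.closure_subset_closure Set.inter_subset_left).trans hF.closure.subset
  · exact (M.closure_subset_closure Set.inter_subset_right).trans hG.closure.subset

/-- Both conditions say that `J \ X` is independent in the contraction by `X`. -/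
theorem IsBasis.indep_sdiff_union_congr {I I' J X : Set α} (hI : M.IsBasis I X)
    (hI' : M.IsBasis I' X) (h : M.Indep ((J \ X) ∪ I)) : M.Indep ((J \ X) ∪ I') := by
  rwa [← hI'.contract_indep_sdiff_iff, hI.contract_indep_sdiff_iff]

/-- If an independent set spans both `X` and `Y`, then flats between `X ∩ Y` and `X`, and between
`X ∩ Y` and `Y`, have a flat as their union, as soon as `X ∪ Y` is a flat. -/
theorem Indep.isFlat_union_of_subset {b X Y U V : Set α} (hb : M.Indep b) (hX : M.IsFlat X)
    (hY : M.IsFlat Y) (hXY : M.IsFlat (X ∪ Y)) (hXb : X ⊆ M.closure (X ∩ b))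
    (hYb : Y ⊆ M.closure (Y ∩ b)) (hU : M.IsFlat U) (hV : M.IsFlat V) (hIU : X ∩ Y ⊆ U)
    (hUX : U ⊆ X) (hIV : X ∩ Y ⊆ V) (hVY : V ⊆ Y) : M.IsFlat (U ∪ V) := by
  have hXB : M.IsBasis (X ∩ b) X :=
    (hb.subset Set.inter_subset_right).isBasis_of_subset_of_subset_closure Set.inter_subset_left hXb
  have hYB : M.IsBasis (Y ∩ b) Y :=
    (hb.subset Set.inter_subset_right).isBasis_of_subset_of_subset_closure Set.inter_subset_left hYb
  have hIi : M.Indep ((X ∩ Y) ∩ b) := hb.subset Set.inter_subset_right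
  have hIB : M.IsBasis ((X ∩ Y) ∩ b) (X ∩ Y) := by
    refine hIi.isBasis_of_subset_of_subset_closure Set.inter_subset_left fun x hx => ?_
    have h := (hb.subset (by simp) : M.Indep ((X ∩ b) ∪ (Y ∩ b))).closure_inter_eq_inter_closure
    rw [Set.inter_inter_distrib_right, h]
    exact ⟨hXb hx.1, hYb hx.2⟩
  obtain ⟨JU, hJU, hIJU⟩ := hIi.subset_isBasis_of_subset (Set.inter_subset_left.trans hIU)
    hU.subset_ground
  obtain ⟨JX, hJX, hJUX⟩ := hJU.indep.subset_isBasis_of_subset (hJU.subset.trans hUX)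
    hX.subset_ground
  obtain ⟨JV, hJV, hIJV⟩ := hIi.subset_isBasis_of_subset (Set.inter_subset_left.trans hIV)
    hV.subset_ground
  obtain ⟨JY, hJY, hJVY⟩ := hJV.indep.subset_isBasis_of_subset (hJV.subset.trans hVY)
    hY.subset_ground
  -- Starting from `b`, replace `X ∩ b` by `JX`, then `Y ∩ b` by `JY`; all these bases agree on `X ∩
  -- Y`.
  have hJ : M.Indep (JX ∪ JY) := by
    have h1 : M.Indep (((Y ∩ b) \ X) ∪ JX) := hXB.indep_sdiff_union_congr hJX (hb.subset (by
      rintro x (hx | hx)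
      exacts [hx.1.2, hx.2]))
    have h2 : M.Indep ((JX \ Y) ∪ JY) := hYB.indep_sdiff_union_congr hJY (h1.subset (by
      rintro x (hx | hx)
      · exact Or.inr hx.1
      · by_cases hxX : x ∈ X
        · exact Or.inr (hJUX (hIJU ⟨⟨hxX, hx.1⟩, hx.2⟩))
        · exact Or.inl ⟨hx, hxX⟩))
    refine h2.subset ?_
    rintro x (hx | hx)
    · by_cases hxY : x ∈ Y
      · have heq := hIB.eq_of_subset_indep (hJX.indep.subset
          (Set.inter_subset_left : JX ∩ (X ∩ Y) ⊆ JX))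
          (fun y hy => ⟨hJUX (hIJU hy), hy.1⟩) Set.inter_subset_right
        have hx' : x ∈ JX ∩ (X ∩ Y) := ⟨hx, hJX.subset hx, hxY⟩
        rw [← heq] at hx'
        exact Or.inr (hJVY (hIJV hx'))
      · exact Or.inl ⟨hx, hxY⟩
    · exact Or.inr hx
  have hUV : U ∪ V ⊆ M.closure (JU ∪ JV) := Set.union_subset
    (hJU.subset_closure.trans (M.closure_subset_closure Set.subset_union_left))
    (hJV.subset_closure.trans (M.closure_subset_closure Set.subset_union_right))
  have hUVE : U ∪ V ⊆ M.E := Set.union_subset hU.subset_ground hV.subset_ground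
  rw [isFlat_iff_closure_eq]
  refine (M.subset_closure _ hUVE).antisymm' fun x hx => ?_
  have hxXY : x ∈ X ∪ Y := by
    have := M.closure_subset_closure (Set.union_subset_union hUX hVY) hx
    rwa [hXY.closure] at this
  have hxJ := M.closure_subset_closure_of_subset_closure hUV hx
  rcases hxXY with hxX | hxY
  · left
    -- A point of `X` spanned by `JU ∪ JV` is spanned by `(JU ∪ JV) ∩ JX`, which lies in the flat
    -- `U`.
    have hi : M.Indep ((JU ∪ JV) ∪ JX) := hJ.subset
      (Set.union_subset (Set.union_subset_union hJUX hJVY) Set.subset_union_left)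
    have h := hi.closure_inter_eq_inter_closure
    have hx' : x ∈ M.closure ((JU ∪ JV) ∩ JX) := h ▸ ⟨hxJ, hJX.subset_closure hxX⟩
    have hsub : (JU ∪ JV) ∩ JX ⊆ U := by
      rintro y ⟨hy | hy, hyX⟩
      exacts [hJU.subset hy, hIU ⟨hJX.subset hyX, hVY (hJV.subset hy)⟩]
    have := M.closure_subset_closure hsub hx'
    rwa [hU.closure] at this
  · right
    have hi : M.Indep ((JU ∪ JV) ∪ JY) := hJ.subset
      (Set.union_subset (Set.union_subset_union hJUX hJVY) Set.subset_union_right)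
    have h := hi.closure_inter_eq_inter_closure
    have hx' : x ∈ M.closure ((JU ∪ JV) ∩ JY) := h ▸ ⟨hxJ, hJY.subset_closure hxY⟩
    have hsub : (JU ∪ JV) ∩ JY ⊆ V := by
      rintro y ⟨hy | hy, hyY⟩
      exacts [hIV ⟨hUX (hJU.subset hy), hJY.subset hyY⟩, hJV.subset hy]
    have := M.closure_subset_closure hsub hx'
    rwa [hV.closure] at this

theorem Indep.isDecomposition {b : Set α} (hb : M.Indep b) {X Y I U : M.FlatLattice}
    (hI : (I : Set α) = (X : Set α) ∩ (Y : Set α)) (hU : (U : Set α) = (X : Set α) ∪ (Y : Set α))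
    (hXb : (X : Set α) ⊆ M.closure (X ∩ b)) (hYb : (Y : Set α) ⊆ M.closure (Y ∩ b)) :
    IsDecomposition I X U := by
  have hIX : I ≤ X := by
    change (I : Set α) ⊆ X
    exact hI ▸ Set.inter_subset_left
  have hXU : X ≤ U := by
    change (X : Set α) ⊆ U
    exact hU ▸ Set.subset_union_left
  have key : ∀ {V W : Set α}, M.IsFlat V → M.IsFlat W → (I : Set α) ⊆ V → V ⊆ X →
      (I : Set α) ⊆ W → W ⊆ Y → M.IsFlat (V ∪ W) := fun hV hW h1 h2 h3 h4 =>
    hb.isFlat_union_of_subset X.2 Y.2 (hU ▸ U.2) hXb hYb hV hW (hI ▸ h1) h2 (hI ▸ h3) h4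
  have mI : ∀ x, x ∈ (I : Set α) ↔ x ∈ (X : Set α) ∧ x ∈ (Y : Set α) := fun x => by rw [hI]; rfl
  have mU : ∀ x, x ∈ (U : Set α) ↔ x ∈ (X : Set α) ∨ x ∈ (Y : Set α) := fun x => by rw [hU]; rfl
  -- The flat `v` between `X` and `U` is `X ∪ (v ∩ Y)`, so the product map takes `(u, v)` to `u ∪ (v
  -- ∩ Y)`.
  let toF : Set.Icc I X × Set.Icc X U → Set.Icc I U := fun p =>
    ⟨⟨(p.1.1 : Set α) ∪ ((p.2.1 : Set α) ∩ Y), key p.1.1.2 (p.2.1.2.inter Y.2) p.1.2.1 p.1.2.2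
      (fun x hx => ⟨p.2.2.1 ((mI x).1 hx).1, ((mI x).1 hx).2⟩) Set.inter_subset_right⟩,
      fun x hx => Or.inl (p.1.2.1 hx),
      Set.union_subset (Set.Subset.trans p.1.2.2 hXU)
        (Set.Subset.trans Set.inter_subset_left p.2.2.2)⟩
  let invF : Set.Icc I U → Set.Icc I X × Set.Icc X U := fun w =>
    (⟨⟨(w.1 : Set α) ∩ X, w.1.2.inter X.2⟩, fun x hx => ⟨w.2.1 hx, hIX hx⟩,
      Set.inter_subset_right⟩,
    ⟨⟨(X : Set α) ∪ ((w.1 : Set α) ∩ Y), key X.2 (w.1.2.inter Y.2) hIX Set.Subset.rfl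
      (fun x hx => ⟨w.2.1 hx, ((mI x).1 hx).2⟩) Set.inter_subset_right⟩,
      Set.subset_union_left, Set.union_subset hXU fun x hx => w.2.2 hx.1⟩)
  have left : Function.LeftInverse invF toF := by
    rintro ⟨⟨u, hIu, huX⟩, ⟨v, hXv, hvU⟩⟩
    refine Prod.ext (Subtype.ext (Subtype.ext ?_)) (Subtype.ext (Subtype.ext ?_))
    · ext x
      change ((x ∈ (u : Set α) ∨ (x ∈ (v : Set α) ∧ x ∈ (Y : Set α))) ∧ x ∈ (X : Set α)) ↔
        x ∈ (u : Set α)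
      have h1 : x ∈ (u : Set α) → x ∈ (X : Set α) := fun h => huX h
      have h2 : x ∈ (I : Set α) → x ∈ (u : Set α) := fun h => hIu h
      have := mI x
      tauto
    · ext x
      change (x ∈ (X : Set α) ∨ ((x ∈ (u : Set α) ∨ (x ∈ (v : Set α) ∧ x ∈ (Y : Set α))) ∧
        x ∈ (Y : Set α))) ↔ x ∈ (v : Set α)
      have h1 : x ∈ (u : Set α) → x ∈ (X : Set α) := fun h => huX h
      have h2 : x ∈ (X : Set α) → x ∈ (v : Set α) := fun h => hXv h
      have h3 : x ∈ (v : Set α) → x ∈ (U : Set α) := fun h => hvU h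
      have := mU x
      tauto
  have right : Function.RightInverse invF toF := by
    rintro ⟨w, hIw, hwU⟩
    refine Subtype.ext (Subtype.ext ?_)
    ext x
    change ((x ∈ (w : Set α) ∧ x ∈ (X : Set α)) ∨
      ((x ∈ (X : Set α) ∨ (x ∈ (w : Set α) ∧ x ∈ (Y : Set α))) ∧ x ∈ (Y : Set α))) ↔
      x ∈ (w : Set α)
    have h1 : x ∈ (I : Set α) → x ∈ (w : Set α) := fun h => hIw h
    have h2 : x ∈ (w : Set α) → x ∈ (U : Set α) := fun h => hwU h
    have := mI x
    have := mU x
    tauto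
  have monoTo : Monotone toF := fun p q h =>
    Set.union_subset_union h.1 (Set.inter_subset_inter_left _ h.2)
  have monoInv : Monotone invF := fun w w' h =>
    ⟨Set.inter_subset_inter_left _ h, Set.union_subset_union_right _
      (Set.inter_subset_inter_left _ h)⟩
  refine ⟨hIX, hXU, (⟨toF, invF, left, right⟩ : _ ≃ _).toOrderIso monoTo monoInv, ?_, ?_⟩
  · rintro ⟨u, hIu, huX⟩
    refine Subtype.ext ?_
    ext x
    change (x ∈ (u : Set α) ∨ (x ∈ (X : Set α) ∧ x ∈ (Y : Set α))) ↔ x ∈ (u : Set α)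
    have h2 : x ∈ (I : Set α) → x ∈ (u : Set α) := fun h => hIu h
    have := mI x
    tauto
  · rintro ⟨v, hXv, hvU⟩
    refine Subtype.ext ?_
    ext x
    change (x ∈ (X : Set α) ∨ (x ∈ (v : Set α) ∧ x ∈ (Y : Set α))) ↔ x ∈ (v : Set α)
    have h2 : x ∈ (X : Set α) → x ∈ (v : Set α) := fun h => hXv h
    have h3 : x ∈ (v : Set α) → x ∈ (U : Set α) := fun h => hvU h
    have := mU x
    tauto

/-- A decomposition `(x, z, y)` in the lattice of flats comes with a complement `z'` of `z` in the
interval `[x, y]` such that `y` is the union of `z` and `z'`, and `z` is the only flat between `x`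
and `z` with a join `y` with `z'`. -/
theorem exists_complement_of_isDecomposition {x z y : M.FlatLattice} (h : IsDecomposition x z y) :
    ∃ z' : M.FlatLattice, x ≤ z' ∧ (y : Set α) = (z : Set α) ∪ (z' : Set α) ∧
      ∀ w : M.FlatLattice, x ≤ w → w ≤ z → (y : Set α) ⊆ M.closure (w ∪ z') → z ≤ w := by
  obtain ⟨hxz, hzy, ψ, hψl, hψr⟩ := h
  let zl : Set.Icc x z := ⟨z, hxz, le_rfl⟩
  let xl : Set.Icc x z := ⟨x, le_rfl, hxz⟩
  let yr : Set.Icc z y := ⟨y, hzy, le_rfl⟩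
  have htop : (ψ (zl, yr) : M.FlatLattice) = y := hψr yr
  -- The complement is the image of (bottom, top) under `ψ`.
  refine ⟨ψ (xl, yr), (ψ (xl, yr)).2.1, ?_, fun w hxw hwz hy => ?_⟩
  · refine Set.Subset.antisymm (fun e he => ?_) (Set.union_subset hzy (ψ (xl, yr)).2.2)
    by_cases hex : e ∈ (x : Set α)
    · exact Or.inl (hxz hex)
    have heE := y.2.subset_ground he
    have hxyE : insert e (x : Set α) ⊆ M.E := Set.insert_subset heE x.2.subset_ground
    -- The flat `a` covers `x`, so its first coordinate `u ≤ a` is `x` or `a`: accordingly `e` lies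
    -- in the complement or in `z`.
    let a : M.FlatLattice := ⟨M.closure (insert e x), M.isFlat_closure _⟩
    have hxa : x ≤ a := fun f hf => M.subset_closure _ hxyE (Or.inr hf)
    have hea : e ∈ (a : Set α) := M.subset_closure _ hxyE (Set.mem_insert e _)
    have hay : a ≤ y := by
      change M.closure _ ⊆ (y : Set α)
      rw [← y.2.closure]
      exact M.closure_subset_closure (Set.insert_subset he (hxz.trans hzy))
    obtain ⟨⟨u, v⟩, huv⟩ := ψ.surjective ⟨a, hxa, hay⟩
    have huv' : (ψ (u, v) : M.FlatLattice) = a := congrArg Subtype.val huv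
    have hua : (u : M.FlatLattice) ≤ a := by
      rw [← hψl u, ← huv']
      exact ψ.monotone (Prod.mk_le_mk.2 ⟨le_rfl, v.2.1⟩)
    by_cases heu : e ∈ ((u : M.FlatLattice) : Set α)
    · exact Or.inl (u.2.2 heu)
    · refine Or.inr ?_
      have hux : u = xl := by
        refine Subtype.ext (le_antisymm (fun f hf => ?_) u.2.1)
        by_contra hfx
        refine heu ?_
        have := M.closure_exchange (X := (x : Set α)) (e := f) (f := e)
          ⟨hua hf, by rwa [x.2.closure]⟩
        rw [← (u : M.FlatLattice).2.closure]
        exact M.closure_subset_closure (Set.insert_subset hf u.2.1) this.1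
      have hle : a ≤ ψ (xl, yr) := by
        rw [← huv', hux]
        exact ψ.monotone (Prod.mk_le_mk.2 ⟨le_rfl, v.2.2⟩)
      exact hle hea
  · let wl : Set.Icc x z := ⟨w, hxw, hwz⟩
    have h1 : w ≤ ψ (wl, yr) := by
      rw [show w = wl from rfl, ← hψl wl]
      exact ψ.monotone (Prod.mk_le_mk.2 ⟨le_rfl, hzy⟩)
    have h2 : (ψ (xl, yr) : M.FlatLattice) ≤ ψ (wl, yr) :=
      ψ.monotone (Prod.mk_le_mk.2 ⟨hxw, le_rfl⟩)
    have h3 : ψ (zl, yr) ≤ ψ (wl, yr) := by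
      change (ψ (zl, yr) : M.FlatLattice) ≤ ψ (wl, yr)
      rw [htop]
      refine Set.Subset.trans hy ?_
      rw [← (ψ (wl, yr) : M.FlatLattice).2.closure]
      exact M.closure_subset_closure (Set.union_subset h1 h2)
    exact (ψ.le_iff_le.1 h3).1

theorem IsTight.of_isDecomposition {ω : M.E → ℝ} {x z y : M.FlatLattice}
    (h : IsDecomposition x z y) (hx : M.IsTight ω x) (hy : M.IsTight ω y) : M.IsTight ω z := by
  obtain ⟨z', hxz', hzz', hz⟩ := exists_complement_of_isDecomposition h
  obtain ⟨hxz, -⟩ := h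
  refine ⟨z.2.subset_ground, fun b hb => ?_⟩
  -- Since `y ∩ b ⊆ w ∪ z'` spans `y`, the uniqueness of `z` gives `z ≤ w`.
  let w : M.FlatLattice := ⟨M.closure (z ∩ b), M.isFlat_closure _⟩
  refine hz w ((hx.2 b hb).trans (M.closure_subset_closure (Set.inter_subset_inter_left _ hxz)))
    ?_ ?_
  · change M.closure _ ⊆ (z : Set α)
    rw [← z.2.closure]
    exact M.closure_subset_closure (by rw [z.2.closure]; exact Set.inter_subset_left)
  · have hzE : (z : Set α) ∩ b ⊆ M.E := Set.inter_subset_left.trans z.2.subset_ground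
    refine (hy.2 b hb).trans (M.closure_subset_closure ?_)
    rw [hzz']
    rintro e ⟨he | he, heb⟩
    exacts [Or.inl (M.subset_closure _ hzE ⟨he, heb⟩), Or.inr he]

end Matroid

/-! ### Closures under decompositions -/

section DecompositionClosure

variable {P : Type*} [PartialOrder P] {G : DecompositionSet P} {A B : Set P}

theorem DecompositionSet.subset_closure : A ⊆ G.closure A :=
  Set.subset_sInter fun _ hB => hB.1

theorem DecompositionSet.mem_closure_of_mem_carrier {x z y : P} (h : (x, z, y) ∈ G.carrier)
    (hx : x ∈ G.closure A) (hy : y ∈ G.closure A) : z ∈ G.closure A :=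
  Set.mem_sInter.2 fun B hB => hB.2 x z y h (hx B hB) (hy B hB)

theorem DecompositionSet.closure_subset (hAB : A ⊆ B)
    (hB : ∀ x z y : P, (x, z, y) ∈ G.carrier → x ∈ B → y ∈ B → z ∈ B) : G.closure A ⊆ B :=
  Set.sInter_subset_of_mem ⟨hAB, hB⟩

/-- Decompositions have `x ≤ z`, so the elements other than `⊥` are closed under them. -/
theorem DecompositionSet.bot_mem_of_bot_mem_closure [OrderBot P] (h : ⊥ ∈ G.closure A) :
    ⊥ ∈ A := by
  by_contra hA
  refine G.closure_subset (B := {x | x ≠ ⊥}) (fun x hx hx' => hA (hx' ▸ hx)) ?_ h rfl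
  intro x z y hG hx _ hz
  obtain ⟨hxz, -⟩ := G.isDecomposition x z y hG
  exact hx (le_bot_iff.1 (hxz.trans hz.le))

theorem DecompositionSet.top_mem_of_top_mem_closure [OrderTop P] (h : ⊤ ∈ G.closure A) :
    ⊤ ∈ A := by
  by_contra hA
  refine G.closure_subset (B := {x | x ≠ ⊤}) (fun x hx hx' => hA (hx' ▸ hx)) ?_ h rfl
  intro x z y hG _ hy hz
  obtain ⟨-, hzy, -⟩ := G.isDecomposition x z y hG
  exact hy (top_le_iff.1 (hz.ge.trans hzy))

end DecompositionClosure

/-! ### Tight flats as decomposition closures of chains -/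

namespace Matroid

variable {α : Type*} {M : Matroid α} [M.Finite]

/-- If `e ∈ F \ A` were unspanned, it could replace some `f ∈ A` of the same weight in `b`; the new
basis is still maximal, so its part in `A` spans `f`, but that part lies in `b \ {f}`. -/
theorem IsTight.union_sdiff {ω : M.E → ℝ} {A F F' : Set α} (hA : M.IsTight ω A)
    (hF : M.IsUpperLevel ω F) (hF' : M.IsUpperLevel ω F')
    (hconst : ∀ e f : M.E, (e : α) ∈ F \ F' → (f : α) ∈ F \ F' → ω e ≤ ω f) :
    M.IsTight ω (F' ∪ (F \ A)) := by
  refine ⟨Set.union_subset hF'.1 (Set.sdiff_subset.trans hF.1), fun b hb e he => ?_⟩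
  by_contra hecl
  have heF' : e ∉ F' := fun h => hecl (M.closure_subset_closure
    (Set.inter_subset_inter_left _ Set.subset_union_left) (hb.subset_closure_inter hF' h))
  obtain ⟨heF, heA⟩ := he.resolve_left heF'
  have heE := hF.1 heF
  have heb : e ∉ b := fun h => hecl (M.mem_closure_of_mem' ⟨he, h⟩ heE)
  obtain ⟨f, hfb, hfF, hfn, hb'⟩ := hb.1.exists_exchange_of_mem_closure
    (hb.subset_closure_inter hF heF) hecl heb
  obtain ⟨hfF', hfA⟩ := not_or.1 hfn
  have hfA : f ∈ A := by
    by_contra h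
    exact hfA ⟨hfF, h⟩
  have hmax := hb.exchange heE (hF.1 hfF) heb hfb hb' (hconst _ _ ⟨hfF, hfF'⟩ ⟨heF, heF'⟩)
  refine hb.1.indep.notMem_closure_sdiff_of_mem hfb
    (M.closure_subset_closure ?_ (hA.2 _ hmax hfA))
  rintro x ⟨hxA, rfl | hx⟩
  exacts [absurd hxA heA, hx]

/-- For a loopless matroid type, the flats that are spanned by each basis of maximal weight arise
from the upper level sets by decompositions. -/
theorem setOf_isTight_eq_closure {ω : M.E → ℝ} (hω : (M.matroidType ω).Loopless) :
    {A : M.FlatLattice | M.IsTight ω A} =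
      (DecompositionSet.max M.FlatLattice).closure {F | M.IsUpperLevel ω F} := by
  set D := DecompositionSet.max M.FlatLattice
  refine Set.Subset.antisymm ?_ (D.closure_subset (fun F hF => IsUpperLevel.isTight hF)
    fun x z y h hx hy => IsTight.of_isDecomposition h hx hy)
  intro A hA
  -- Induction up the chain of upper level sets `F`, reaching `A ∩ F` from `A ∩ L` for the next
  -- smaller level set `L`.
  have key : ∀ n : ℕ, ∀ F B : M.FlatLattice, (F : Set α).ncard = n → M.IsUpperLevel ω F →
      (B : Set α) = (A : Set α) ∩ (F : Set α) → B ∈ D.closure {F | M.IsUpperLevel ω F} := by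
    intro n
    induction n using Nat.strong_induction_on with
    | _ n ih =>
      intro F B hn hF hB
      rcases (F : Set α).eq_empty_or_nonempty with hemp | ⟨x, hx⟩
      · have : B = F := Subtype.ext (by rw [hB, hemp, Set.inter_empty])
        exact this ▸ D.subset_closure hF
      have : Finite M.E := M.ground_finite
      obtain ⟨e, heF, hmin⟩ := (Set.toFinite {x : M.E | (x : α) ∈ (F : Set α)}).exists_minimalFor
        ω _ ⟨⟨x, hF.1 hx⟩, hx⟩
      have hle : ∀ f : M.E, (f : α) ∈ (F : Set α) → ω e ≤ ω f := fun f hf =>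
        (le_total (ω e) (ω f)).elim id fun h => hmin hf h
      have hL := M.isUpperLevel_lt ω (ω e)
      set L : Set α := {x | ∃ h : x ∈ M.E, ω e < ω ⟨x, h⟩}
      have hLF : L ⊆ F := fun y hy => hF.2 e ⟨y, hy.1⟩ heF hy.2.le
      have hA' : M.IsTight ω A := hA
      have hFt := hF.isTight
      have hLt := hL.isTight
      have hAL := hA'.inter hLt
      have hAF := hA'.inter hFt
      have hGt := hLt.union hAF
      have hGt' := hA'.union_sdiff hF hL (by
        rintro f g ⟨hf, hfL⟩ ⟨hg, -⟩
        exact (not_lt.1 fun h => hfL ⟨f.2, h⟩).trans (hle g hg))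
      let L' : M.FlatLattice := ⟨L, hLt.isFlat hω⟩
      let B' : M.FlatLattice := ⟨A ∩ L, hAL.isFlat hω⟩
      let G : M.FlatLattice := ⟨L ∪ (A ∩ F), hGt.isFlat hω⟩
      let G' : M.FlatLattice := ⟨L ∪ (F \ A), hGt'.isFlat hω⟩
      obtain ⟨b, hb⟩ := M.exists_isMaxWeightBase ω
      have hBmem : B' ∈ D.closure {F | M.IsUpperLevel ω F} := by
        refine ih L.ncard ?_ L' B' rfl hL rfl
        rw [← hn]
        refine Set.ncard_lt_ncard ⟨hLF, fun h => ?_⟩ (M.ground_finite.subset hF.1)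
        exact lt_irrefl _ (h heF).2
      have hGmem : G ∈ D.closure {F | M.IsUpperLevel ω F} := by
        -- `G` and `G'` meet in `L` and have union `F`.
        have hdec : IsDecomposition L' G F := hb.1.indep.isDecomposition (Y := G')
          (by
            ext y
            simp only [L', G, G', Set.mem_inter_iff, Set.mem_union, Set.mem_sdiff]
            tauto)
          (by
            ext y
            have := @hLF y
            simp only [G, G', Set.mem_inter_iff, Set.mem_union, Set.mem_sdiff]
            tauto)
          (hGt.2 b hb) (hGt'.2 b hb)
        exact D.mem_closure_of_mem_carrier hdec (D.subset_closure hL) (D.subset_closure hF)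
      -- `A ∩ F` and `L` meet in `A ∩ L` and have union `G`.
      have hdec : IsDecomposition B' B G := hb.1.indep.isDecomposition (Y := L')
        (by
          ext y
          have := @hLF y
          simp only [B', L', hB, Set.mem_inter_iff]
          tauto)
        (by
          ext y
          simp only [G, L', hB, Set.mem_inter_iff, Set.mem_union]
          tauto)
        (by rw [hB]; exact hAF.2 b hb) (hLt.2 b hb)
      exact D.mem_closure_of_mem_carrier hdec hBmem hGmem
  refine key _ ⊤ A rfl ⟨Set.Subset.rfl, fun _ f _ _ => f.2⟩ ?_
  exact (Set.inter_eq_self_of_subset_left A.2.subset_ground).symm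

/-- A chain of flats that contains bottom and top is the set of upper level sets of some weight. -/
theorem exists_weight_of_isChain [M.Loopless] {C : Set M.FlatLattice} (hC : IsChain (· ≤ ·) C)
    (hbot : ⊥ ∈ C) (htop : ⊤ ∈ C) :
    ∃ ω : M.E → ℝ, ∀ S : Set α, M.IsUpperLevel ω S ↔ ∃ F ∈ C, (F : Set α) = S := by
  have : Finite M.FlatLattice :=
    (M.ground_finite.finite_subsets.subset fun F (hF : M.IsFlat F) => hF.subset_ground).to_subtype
  have hfin : C.Finite := Set.toFinite C
  let W : M.E → Set M.FlatLattice := fun e => {F | F ∈ C ∧ (e : α) ∈ (F : Set α)}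
  have hWfin : ∀ e, (W e).Finite := fun e => Set.toFinite _
  -- The weight of `e` counts the members of the chain that contain `e`.
  let ω : M.E → ℝ := fun e => (W e).ncard
  have hlt : ∀ F ∈ C, ∀ e f : M.E, (e : α) ∈ (F : Set α) → (f : α) ∉ (F : Set α) →
      ω f < ω e := by
    intro F hF e f he hf
    refine Nat.cast_lt.2 (Set.ncard_lt_ncard ⟨?_, fun h => hf (h ⟨hF, he⟩).2⟩ (hWfin e))
    rintro G ⟨hG, hfG⟩
    refine ⟨hG, ?_⟩
    rcases hC.total hF hG with h | h
    exacts [h he, absurd (h hfG) hf]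
  have hup : ∀ F ∈ C, M.IsUpperLevel ω F := by
    refine fun F hF => ⟨F.2.subset_ground, fun e f he hef => ?_⟩
    by_contra hf
    exact absurd hef (not_le.2 (hlt F hF e f he hf))
  refine ⟨ω, fun S => ⟨fun hS => ?_, ?_⟩⟩
  · rcases S.eq_empty_or_nonempty with rfl | ⟨x, hx⟩
    · exact ⟨⊥, hbot, M.loops_eq_empty⟩
    have : Finite M.E := M.ground_finite
    obtain ⟨e, heS, hmin⟩ := (Set.toFinite {x : M.E | (x : α) ∈ S}).exists_minimalFor
      ω _ ⟨⟨x, hS.1 hx⟩, hx⟩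
    have hle : ∀ f : M.E, (f : α) ∈ S → ω e ≤ ω f := fun f hf =>
      (le_total (ω e) (ω f)).elim id fun h => hmin hf h
    -- `S` is the least member of the chain containing its lightest element `e`.
    obtain ⟨F, hF, hFmin⟩ := (hWfin e).exists_minimal ⟨⊤, htop, e.2⟩
    refine ⟨F, hF.1, Set.Subset.antisymm (fun f hf => ?_) fun f hf => ?_⟩
    · have hfE := F.2.subset_ground hf
      refine hS.2 e ⟨f, hfE⟩ heS (Nat.cast_le.2 (Set.ncard_le_ncard ?_ (hWfin _)))
      intro G hG
      refine ⟨hG.1, ?_⟩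
      rcases hC.total hF.1 hG.1 with h | h
      exacts [h hf, hFmin hG h hf]
    · exact (hup F hF.1).2 e ⟨f, hS.1 hf⟩ hF.2 (hle ⟨f, hS.1 hf⟩ hf)
  · rintro ⟨F, hF, rfl⟩
    exact hup F hF

theorem setOf_isTight_mem_decompositionComplex {ω : M.E → ℝ} (hω : (M.matroidType ω).Loopless) :
    {A : M.FlatLattice | M.IsTight ω A} ∈
      decompositionComplex M.FlatLattice (DecompositionSet.max M.FlatLattice) :=
  ⟨{F | M.IsUpperLevel ω F}, ⟨⊤, Set.Subset.rfl, fun _ f _ _ => f.2⟩,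
    fun _ hF _ hG _ => hF.total hG, setOf_isTight_eq_closure hω⟩

theorem setOf_isTight_subset_iff {ω ω' : M.E → ℝ} (hω : (M.matroidType ω).Loopless) :
    {A : M.FlatLattice | M.IsTight ω A} ⊆ {A : M.FlatLattice | M.IsTight ω' A} ↔
      M.typeCone ω ⊆ M.typeCone ω' := by
  rw [typeCone_subset_iff]
  refine ⟨fun h b hb => isMaxWeightBase_of_isTight (fun S hS => ?_) hb,
    fun h A hA => ⟨hA.1, fun b hb => hA.2 b (h b hb)⟩⟩
  exact h (show (⟨S, hS.isTight.isFlat hω⟩ : M.FlatLattice) ∈ {A : M.FlatLattice | M.IsTight ω A}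
    from hS.isTight)

end Matroid

/-! ### The embedding and its image -/

open Matroid in
theorem mainTheorem4 {α : Type*} (M : Matroid α) [M.Finite] [M.Loopless] :
    -- faces of the Bergman fan correspond to loopfree matroid types under reversed inclusion of bases
    (∀ ω ω' : M.E → ℝ, (M.matroidType ω).Loopless → (M.matroidType ω').Loopless →
      (M.typeCone ω ⊆ M.typeCone ω' ↔
        ∀ b, (M.matroidType ω').IsBase b → (M.matroidType ω).IsBase b)) ∧
    -- the map is a well-defined embedding of posets with the stated image
    ∃ Ψ : M.bergmanFan ↪o
        decompositionComplex M.FlatLattice (DecompositionSet.max M.FlatLattice),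
      (∀ (ω : M.E → ℝ) (hω : (M.matroidType ω).Loopless),
        (Ψ ⟨M.typeCone ω, ω, hω, rfl⟩ : Set M.FlatLattice) =
          {A : M.FlatLattice | ∀ b, (M.matroidType ω).IsBase b →
            M.eRk (A : Set α) = ((A : Set α) ∩ b).encard}) ∧
      ∀ A : decompositionComplex M.FlatLattice (DecompositionSet.max M.FlatLattice),
        A ∈ Set.range Ψ ↔ ⊥ ∈ (A : Set M.FlatLattice) ∧ ⊤ ∈ (A : Set M.FlatLattice) := by
  refine ⟨fun ω ω' _ _ => typeCone_subset_iff, ?_⟩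
  -- The embedding is built from a chosen weight for each cone; `hΨ` shows that the choice is
  -- immaterial, as the cone determines the tight flats.
  choose ω hω hσ using fun σ : M.bergmanFan => σ.2
  let Ψ : M.bergmanFan ↪o
      decompositionComplex M.FlatLattice (DecompositionSet.max M.FlatLattice) :=
    OrderEmbedding.ofMapLEIff
      (fun σ => ⟨_, setOf_isTight_mem_decompositionComplex (hω σ)⟩) (fun σ τ => by
        rw [← Subtype.coe_le_coe, ← Subtype.coe_le_coe, hσ σ, hσ τ]
        exact setOf_isTight_subset_iff (hω σ))
  have hΨ : ∀ (ν : M.E → ℝ) (hν : (M.matroidType ν).Loopless),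
      (Ψ ⟨M.typeCone ν, ν, hν, rfl⟩ : Set M.FlatLattice) =
        {A : M.FlatLattice | M.IsTight ν A} := by
    intro ν hν
    have h := hσ ⟨M.typeCone ν, ν, hν, rfl⟩
    exact Set.Subset.antisymm ((setOf_isTight_subset_iff (hω _)).2 h.ge)
      ((setOf_isTight_subset_iff hν).2 h.le)
  refine ⟨Ψ, fun ν hν => ?_, ?_⟩
  · rw [hΨ ν hν]
    ext A
    exact isTight_iff_eRk_eq A.2.subset_ground
  rintro ⟨_, C, hne, hC, rfl⟩
  constructor
  · rintro ⟨⟨_, ν, hν, rfl⟩, hA⟩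
    rw [← hA, hΨ ν hν]
    have hbot : ((⊥ : M.FlatLattice) : Set α) = ∅ := M.loops_eq_empty
    refine ⟨?_, IsUpperLevel.isTight ⟨Set.Subset.rfl, fun _ f _ _ => f.2⟩⟩
    change M.IsTight ν ((⊥ : M.FlatLattice) : Set α)
    rw [hbot]
    exact ⟨Set.empty_subset _, fun _ _ => Set.empty_subset _⟩
  · rintro ⟨hbot, htop⟩
    obtain ⟨ν, hν⟩ := exists_weight_of_isChain hC (DecompositionSet.bot_mem_of_bot_mem_closure hbot)
      (DecompositionSet.top_mem_of_top_mem_closure htop)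
    have hl : (M.matroidType ν).Loopless := matroidType_loopless_of_isFlat fun S hS => by
      obtain ⟨F, -, rfl⟩ := (hν S).1 hS
      exact F.2
    refine ⟨⟨M.typeCone ν, ν, hl, rfl⟩, Subtype.ext ?_⟩
    rw [hΨ ν hl, setOf_isTight_eq_closure hl]
    congr 1
    ext F
    refine (hν F).trans ⟨?_, fun hF => ⟨F, hF, rfl⟩⟩
    rintro ⟨G, hG, hGF⟩
    exact Subtype.ext hGF ▸ hG
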